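/- Let $X$ be a locally compact Hausdorff space with countable base, and let $\mathfrak X=(\Omega,X_t,\theta_t,\mathbb P^x)$ be a diffusion on $X$, i.e. a Hunt process on $X$ (with cemetery the point at infinity of the one-point compactification of $X$, isolated if $X$ is compact; the lifetime may be finite) whose trajectories are continuous up to the lifetime. For open $U\subset X$ let $\tau_U:=\inf\{t\ge 0: X_t\in X\setminus U\}$ be the exit time, $$H_U(x,B):=\mathbb P^x[X_{\tau_U}\in B,\ \tau_U<\infty]\quad(x\in X,\ B\subset X \text{ Borel}),\qquad p_U(x):=\mathbb E^x\tau_U ,$$ and write $H_Uf(x):=\int f\,dH_U(x,\cdot)$. Consider the following conditions on an open set $V$. - $(D_1)$ $V$ is relatively compact, and $p_V$ is real-valued and continuous on $V$ and tends to zero at $\partial V$. - $(D_2)$ For all $z\in\partial V$ and all neighborhoods $W$ of $z$, $\lim_{x\to z}H_V(x,X\setminus W)=0$; and $(H_Vf)|_V$ is continuous for every bounded Borel function $f$ on $X$. $\mathfrak X$ is called a Bauer diffusion if the topology of $X$ has a base all of whose members satisfy $(D_1)$ and $(D_2)$. Let $\mathcal V$ be a base for the topology of $X$ consisting of relatively compact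 open sets. A *boundary kernel* for an open set $V$ is a kernel $T$ on $X$ with $T(x,X\setminus\partial V)=0$ for $x\in V$ and $T(x,\cdot)=\varepsilon_x$ for $x\notin V$. Suppose that a boundary kernel $H_V$ for $V$ is given for each $V\in\mathcal V$. A *local choice* $\mathcal W$ from $\mathcal V$ in an open set $U$ assigns to each $x\in U$ a fundamental system $\mathcal W(x)$ of neighborhoods of $x$ consisting of sets $W\in\mathcal V$ with $\overline W\subset U$. A lower semicontinuous function $u:U\to{]-\infty,\infty]}$ is *$\mathcal W$-hyperharmonic on $U$* if $H_Wu(x)\le u(x)$ for all $x\in U$ and $W\in\mathcal W(x)$; it is *hyperharmonic on $U$* if this holds for all $x\in U$ and all $W\in\mathcal V$ with $x\in W$ and $\overline W\subset U$. The family $(H_V)_{V\in\mathcal V}$ is a *normal Bauer family of harmonic boundary kernels* if, for every $V\in\mathcal V$: - $(H_1)$ $H_WH_V=H_V$ for every $W\in\mathcal V$ with $W\subset V$; - $(H_2)$ $H_Vf$ is a continuous real function on $X$ for every continuous $f:X\to\mathbb R$, and $H_V1=1$; - $(H_3)$ there is a local choice $\mathcal W$ from $\mathcal V$ in $V$ such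 that the positive $\mathcal W$-hyperharmonic functions on $V$ separate the points of $V$; - $(H_4)$ $H_Vf$ is continuous on $V$ for every bounded Borel function $f$ on $X$. **Proposition.** Let $\mathfrak X$ be a Bauer diffusion on $X$ and let $\mathcal V$ be a base for the topology of $X$, consisting of relatively compact open sets, such that every $V\in\mathcal V$ satisfies $(D_1)$ and $(D_2)$. Then, for all $U,V\in\mathcal V$ with $\overline U\subset V$, the functions $p_V$ and $H_Up_V$ are hyperharmonic on $V$ (with respect to the exit kernels $H_W$, $W\in\mathcal V$), and $$p_V-H_Up_V=p_U>0\quad\text{on } U$$ (all terms being finite on $U$). In particular, the exit kernels $(H_V)_{V\in\mathcal V}$ form a normal Bauer family of harmonic boundary kernels on $X$. -/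

import Mathlib

open Set Filter MeasureTheory
open scoped NNReal ENNReal Topology

/-- The state space with cemetery, the one-point compactification of `X` (in which the added point
is isolated if `X` is compact), carries its Borel σ-algebra. -/
instance onePointMeasurableSpace (X : Type*) [TopologicalSpace X] :
    MeasurableSpace (OnePoint X) := borel (OnePoint X)

instance onePointBorelSpace (X : Type*) [TopologicalSpace X] : BorelSpace (OnePoint X) := ⟨rfl⟩

/-- The state `Z_T` at a random time `T : Ω → [0, ∞]`, with the convention that `Z_∞` is the
cemetery `OnePoint.infty`. -/
noncomputable def stateAt {X Ω : Type*} (Z : ℝ≥0 → Ω → OnePoint X) (T : Ω → ℝ≥0∞) (ω : Ω) :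
    OnePoint X :=
  open scoped Classical in
  if T ω = ⊤ then OnePoint.infty else Z (T ω).toNNReal ω

/-- A Hunt process with state space `X` and cemetery `OnePoint.infty` (so the lifetime may be
finite), given on the measurable space `Ω`. -/
structure HuntProcess (X : Type*) [TopologicalSpace X] (Ω : Type*) [mΩ : MeasurableSpace Ω] where
  /-- the state at time `t` -/
  Z : ℝ≥0 → Ω → OnePoint X
  /-- the shift operators -/
  θ : ℝ≥0 → Ω → Ω
  /-- the law of the process started in `x` -/
  P : OnePoint X → Measure Ω
  /-- the admissible filtration -/
  𝓜 : Filtration ℝ≥0 mΩ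
  isProbabilityMeasure : ∀ x, IsProbabilityMeasure (P x)
  /-- the filtration is right-continuous, and the process is adapted to it -/
  rightContinuous : 𝓜.IsRightContinuous
  adapted : ∀ t, Measurable[𝓜 t] (Z t)
  /-- probabilities of events generated by the process are Borel functions of the initial state -/
  measurable_P : ∀ A : Set Ω,
    MeasurableSet[⨆ t, MeasurableSpace.comap (Z t) (onePointMeasurableSpace X)] A →
      Measurable fun x => P x A
  /-- the process started in `x` starts in `x` -/
  start : ∀ x, ∀ᵐ ω ∂(P x), Z 0 ω = x
  /-- the cemetery is a trap -/
  trap : ∀ ω s t, s ≤ t → Z s ω = OnePoint.infty → Z t ω = OnePoint.infty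
  shift : ∀ s t ω, Z s (θ t ω) = Z (s + t) ω
  /-- the paths are right-continuous and have left limits, in `OnePoint X` -/
  path_right : ∀ ω t, ContinuousWithinAt (fun s => Z s ω) (Ici t) t
  path_left : ∀ ω t, 0 < t → ∃ l : OnePoint X, Tendsto (fun s => Z s ω) (𝓝[<] t) (𝓝 l)
  /-- the strong Markov property: given the past of a stopping time `T`, on `{T < ∞}` the shifted
  process has the law `P` with starting point `Z_T` -/
  strongMarkov : ∀ (T : Ω → ℝ≥0∞) (hT : IsStoppingTime 𝓜 T) (x : OnePoint X) (Λ A : Set Ω),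
    MeasurableSet[hT.measurableSpace] Λ →
    MeasurableSet[⨆ t, MeasurableSpace.comap (Z t) (onePointMeasurableSpace X)] A →
      P x {ω | ω ∈ Λ ∧ T ω ≠ ⊤ ∧ θ (T ω).toNNReal ω ∈ A} =
        ∫⁻ ω in {ω | ω ∈ Λ ∧ T ω ≠ ⊤}, P (stateAt Z T ω) A ∂(P x)
  /-- quasi-left-continuity -/
  quasiLeftContinuous : ∀ (S : ℕ → Ω → ℝ≥0∞) (T : Ω → ℝ≥0∞),
    (∀ n, IsStoppingTime 𝓜 (S n)) → (∀ ω, Monotone fun n => S n ω) → (∀ ω, T ω = ⨆ n, S n ω) →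
      ∀ x, ∀ᵐ ω ∂(P x), T ω ≠ ⊤ →
        Tendsto (fun n => stateAt Z (S n) ω) atTop (𝓝 (stateAt Z T ω))

namespace HuntProcess

variable {X : Type*} [TopologicalSpace X] {Ω : Type*} [MeasurableSpace Ω]

/-- A diffusion is a Hunt process all of whose trajectories are continuous during the lifetime. -/
def IsDiffusion (𝔛 : HuntProcess X Ω) : Prop :=
  ∀ ω, ContinuousOn (fun t => 𝔛.Z t ω) {t | 𝔛.Z t ω ≠ OnePoint.infty}

/-- The exit time `τ_U = inf {t ≥ 0 : Z_t ∈ X \ U}` (with `inf ∅ = ∞`). -/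
noncomputable def exitTime (𝔛 : HuntProcess X Ω) (U : Set X) (ω : Ω) : ℝ≥0∞ :=
  sInf {r | ∃ t : ℝ≥0, r = t ∧ ∃ y ∈ Uᶜ, 𝔛.Z t ω = (y : OnePoint X)}

/-- The exit kernel: `H_U (x, B) = P^x [Z_{τ_U} ∈ B, τ_U < ∞]`. The comap restricts the law of
`Z_{τ_U}` (which is the cemetery if `τ_U = ∞`) to `X`. -/
noncomputable def exitKernel [MeasurableSpace X] (𝔛 : HuntProcess X Ω) (U : Set X) (x : X) :
    Measure X :=
  ((𝔛.P x).map (stateAt 𝔛.Z (𝔛.exitTime U))).comap ((↑) : X → OnePoint X)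

/-- The expected exit time `p_U (x) = E^x τ_U`. -/
noncomputable def expectedExitTime (𝔛 : HuntProcess X Ω) (U : Set X) (x : X) : ℝ≥0∞ :=
  ∫⁻ ω, 𝔛.exitTime U ω ∂(𝔛.P x)

/-- `V` is relatively compact, and `p_V` is a continuous real function on `V` which tends to zero
at the boundary of `V`. -/
def D1 (𝔛 : HuntProcess X Ω) (V : Set X) : Prop :=
  IsCompact (closure V) ∧ (∀ x ∈ V, 𝔛.expectedExitTime V x ≠ ⊤) ∧
    ContinuousOn (𝔛.expectedExitTime V) V ∧
    ∀ z ∈ frontier V, Tendsto (𝔛.expectedExitTime V) (𝓝[V] z) (𝓝 0)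

/-- `lim_{x → z} H_V (x, X \ W) = 0` for the (open) neighborhoods `W` of the boundary points `z`,
and `H_V f` is continuous on `V` for every bounded Borel function `f`. -/
def D2 [MeasurableSpace X] (𝔛 : HuntProcess X Ω) (V : Set X) : Prop :=
  (∀ z ∈ frontier V, ∀ W : Set X, IsOpen W → z ∈ W →
    Tendsto (fun x => 𝔛.exitKernel V x Wᶜ) (𝓝 z) (𝓝 0)) ∧
  ∀ f : X → ℝ, Measurable f → (∃ C, ∀ y, |f y| ≤ C) →
    ContinuousOn (fun x => ∫ y, f y ∂(𝔛.exitKernel V x)) V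

/-- A Bauer diffusion. -/
def IsBauerDiffusion [MeasurableSpace X] (𝔛 : HuntProcess X Ω) : Prop :=
  𝔛.IsDiffusion ∧ ∃ 𝓥 : Set (Set X), TopologicalSpace.IsTopologicalBasis 𝓥 ∧
    ∀ V ∈ 𝓥, 𝔛.D1 V ∧ 𝔛.D2 V

end HuntProcess

section Analytic

variable {X : Type*} [TopologicalSpace X] [MeasurableSpace X]

/-- `T` is a kernel on `X` with `T(x, X \ ∂U) = 0` for `x ∈ U` and `T(x, ·) = ε_x` for `x ∉ U`.
Measurability of `T` into the measures on `X` says that all `x ↦ T(x, B)`, `B` Borel, are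
measurable. -/
def IsBoundaryKernel (T : X → Measure X) (U : Set X) : Prop :=
  Measurable T ∧ (∀ x ∈ U, T x (frontier U)ᶜ = 0) ∧ ∀ x ∉ U, T x = Measure.dirac x

/-- The integral of an extended real function whose negative part has a finite integral: the
integral of the positive part minus the integral of the negative part. -/
noncomputable def erealIntegral (μ : Measure X) (u : X → EReal) : EReal :=
  ((∫⁻ y, (u y).toENNReal ∂μ : ℝ≥0∞) : EReal) - ((∫⁻ y, (-u y).toENNReal ∂μ : ℝ≥0∞) : EReal)

/-- `𝓦` is a local choice from `𝓥` in `U`: each `𝓦 x`, `x ∈ U`, is a fundamental system of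
neighborhoods of `x` consisting of sets from `𝓥` with closure contained in `U`. -/
def IsLocalChoice (𝓥 : Set (Set X)) (U : Set X) (𝓦 : X → Set (Set X)) : Prop :=
  ∀ x ∈ U, (∀ W ∈ 𝓦 x, W ∈ 𝓥 ∧ closure W ⊆ U) ∧ (𝓝 x).HasBasis (fun W => W ∈ 𝓦 x) id

/-- `u` is `𝓦`-hyperharmonic on `U` with respect to the kernels `H W`. Only the values of `u` on
`U` matter, since `H W x`, `x ∈ W`, will be carried by `∂W ⊆ U`; the negative part of `u` is bounded
on this compact set. -/
def IsLocallyHyperharmonic (H : Set X → X → Measure X) (𝓦 : X → Set (Set X)) (U : Set X)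
    (u : X → EReal) : Prop :=
  LowerSemicontinuousOn u U ∧ (∀ x ∈ U, u x ≠ ⊥) ∧
    ∀ x ∈ U, ∀ W ∈ 𝓦 x, erealIntegral (H W x) u ≤ u x

/-- `u` is hyperharmonic on `U`: the local choice consists of all `W ∈ 𝓥` with closure contained
in `U` and `x ∈ W`. -/
def IsHyperharmonic (𝓥 : Set (Set X)) (H : Set X → X → Measure X) (U : Set X)
    (u : X → EReal) : Prop :=
  IsLocallyHyperharmonic H (fun x => {W | W ∈ 𝓥 ∧ closure W ⊆ U ∧ x ∈ W}) U u

/-- `(H V)`, `V ∈ 𝓥`, is a normal Bauer family of harmonic boundary kernels on `X`. -/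
structure IsNormalBauerFamily (𝓥 : Set (Set X)) (H : Set X → X → Measure X) : Prop where
  isTopologicalBasis : TopologicalSpace.IsTopologicalBasis 𝓥
  isCompact_closure : ∀ V ∈ 𝓥, IsCompact (closure V)
  isBoundaryKernel : ∀ V ∈ 𝓥, IsBoundaryKernel (H V) V
  /-- `H_W H_V = H_V` if `W ⊆ V` -/
  comp_eq : ∀ V ∈ 𝓥, ∀ W ∈ 𝓥, W ⊆ V → ∀ x, ∀ B, MeasurableSet B →
    ∫⁻ y, H V y B ∂(H W x) = H V x B
  /-- `H_V` maps continuous real functions to continuous real functions -/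
  continuous : ∀ V ∈ 𝓥, ∀ f : X → ℝ, Continuous f →
    (∀ x, Integrable f (H V x)) ∧ Continuous fun x => ∫ y, f y ∂(H V x)
  /-- `H_V 1 = 1` -/
  normal : ∀ V ∈ 𝓥, ∀ x, H V x univ = 1
  /-- for some local choice `𝓦` on `V`, the positive `𝓦`-hyperharmonic functions on `V` separate
  the points of `V` -/
  separates : ∀ V ∈ 𝓥, ∃ 𝓦 : X → Set (Set X), IsLocalChoice 𝓥 V 𝓦 ∧
    ∀ x ∈ V, ∀ y ∈ V, x ≠ y → ∃ u : X → EReal, IsLocallyHyperharmonic H 𝓦 V u ∧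
      (∀ z ∈ V, 0 ≤ u z) ∧ u x ≠ u y
  /-- `H_V f` is continuous on `V` for every bounded Borel function `f` -/
  continuousOn : ∀ V ∈ 𝓥, ∀ f : X → ℝ, Measurable f → (∃ C, ∀ y, |f y| ≤ C) →
    ContinuousOn (fun x => ∫ y, f y ∂(H V x)) V

end Analytic

/-! Everything rests on the strong Markov property at the exit time of `W`. If `W ⊆ V`, a path
leaves `V` no earlier than `W`, so `τ_V = τ_W + τ_V ∘ θ_{τ_W}` and the exit state from `V` is
unchanged by the shift. Taking expectations gives `p_V = p_W + H_W p_V` (`expectedExitTime_eq`) and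
`H_W H_V = H_V` (`lintegral_exitKernel_exitKernel`). The first identity makes `p_V` hyperharmonic
and, applied to `U`, yields `p_V - H_U p_V = p_U`, which is positive on `U` because paths are
right-continuous.

For hyperharmonicity of `H_U p_V`, the set `W` need not be comparable with `U`. In general only `p_U
≤ p_W + H_W p_U` survives (`expectedExitTime_le`), but inserting `p_V = p_U + H_U p_V` and
cancelling finite terms gives `H_W H_U p_V ≤ H_U p_V`.

Separation of `x ≠ y` follows: if `p_V` fails to separate them, then `H_U p_V` succeeds for a small
`U` around `x` that misses `y`, since `p_U` vanishes at `y` but not at `x`. Beyond this, continuity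
of paths places the exit state on the boundary and makes exit times measurable, and `D1` and `D2`
give continuity of `H_V f`. -/

/-! ### Topology of the state space and evaluation at random times -/

theorem onePoint_secondCountableTopology (X : Type*) [TopologicalSpace X] [T2Space X]
    [LocallyCompactSpace X] [SecondCountableTopology X] : SecondCountableTopology (OnePoint X) := by
  let K := CompactExhaustion.choice X
  -- Complements of an exhaustion by compact sets give countably many neighborhoods of infinity.
  have hb : TopologicalSpace.IsTopologicalBasis
      ((fun s : Set X => ((↑) '' s : Set (OnePoint X))) '' TopologicalSpace.countableBasis X ∪
        range fun n => ((↑) '' K n : Set (OnePoint X))ᶜ) := by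
    refine TopologicalSpace.isTopologicalBasis_of_isOpen_of_nhds ?_ ?_
    · rintro u (⟨s, hs, rfl⟩ | ⟨n, rfl⟩)
      · exact OnePoint.isOpenEmbedding_coe.isOpenMap _ (TopologicalSpace.isOpen_of_mem_countableBasis hs)
      · exact ((OnePoint.isClosed_image_coe).2
          ⟨(K.isCompact n).isClosed, K.isCompact n⟩).isOpen_compl
    · intro a u ha hu
      induction a using OnePoint.rec with
      | infty =>
        have hc : IsCompact ((↑) ⁻¹' u : Set X)ᶜ := by
          simpa using ((OnePoint.isOpen_def).1 hu).1 ha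
        obtain ⟨n, hn⟩ := K.exists_superset_of_isCompact hc
        refine ⟨_, Or.inr ⟨n, rfl⟩, by simp, ?_⟩
        intro z hz
        induction z using OnePoint.rec with
        | infty => exact ha
        | coe z =>
          by_contra hzu
          exact hz ⟨z, hn hzu, rfl⟩
      | coe x =>
        obtain ⟨s, hs, hxs, hsu⟩ := (TopologicalSpace.isBasis_countableBasis X).exists_subset_of_mem_open
          (show x ∈ (↑) ⁻¹' u from ha) (hu.preimage OnePoint.continuous_coe)
        exact ⟨_, Or.inl ⟨s, hs, rfl⟩, ⟨x, hxs, rfl⟩, by simpa using hsu⟩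
  exact hb.secondCountableTopology
    (((TopologicalSpace.countable_countableBasis X).image _).union (countable_range _))

/-- Metrizability makes pointwise limits of measurable maps measurable and lets closed sets be
described by a distance function. -/
theorem onePoint_metrizableSpace (X : Type*) [TopologicalSpace X] [T2Space X]
    [LocallyCompactSpace X] [SecondCountableTopology X] :
    TopologicalSpace.MetrizableSpace (OnePoint X) :=
  haveI := onePoint_secondCountableTopology X
  TopologicalSpace.metrizableSpace_of_t3_secondCountable _

/-- A right-continuous process evaluated at a measurable random time is measurable. -/
theorem measurable_eval_randomTime {Ω Y : Type*} [MeasurableSpace Ω] [TopologicalSpace Y]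
    [TopologicalSpace.PseudoMetrizableSpace Y] [MeasurableSpace Y] [BorelSpace Y]
    {Z : ℝ≥0 → Ω → Y} (hZ : ∀ t, Measurable (Z t))
    (hr : ∀ ω t, ContinuousWithinAt (fun s => Z s ω) (Ici t) t)
    {T : Ω → ℝ≥0} (hT : Measurable T) : Measurable fun ω => Z (T ω) ω := by
  have hcount : ∀ (g : ℕ → ℝ≥0) (N : Ω → ℕ), Measurable N → Measurable fun ω => Z (g (N ω)) ω := by
    intro g N hN
    have h1 : Measurable fun p : ℕ × Ω => Z (g p.1) p.2 :=
      measurable_from_prod_countable_right fun k => hZ (g k)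
    exact h1.comp (hN.prodMk measurable_id)
  have hfloor : ∀ n : ℕ, Measurable fun ω => ⌊T ω * (n + 1)⌋₊ := fun n =>
    (hT.mul_const ((n : ℝ≥0) + 1)).nat_floor
  -- Countably valued times in `(T, T + 1/(n+1)]`; approximating from the right is what
  -- right-continuity requires.
  have happ : ∀ n : ℕ, Measurable fun ω =>
      Z (((⌊T ω * (n + 1)⌋₊ : ℝ≥0) + 1) / (n + 1)) ω := fun n =>
    hcount (fun k => ((k : ℝ≥0) + 1) / (n + 1)) _ (hfloor n)
  refine measurable_of_tendsto_metrizable happ (tendsto_pi_nhds.2 fun ω => ?_)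
  refine (hr ω (T ω)).tendsto.comp (tendsto_nhdsWithin_iff.2 ⟨?_, Eventually.of_forall fun n => ?_⟩)
  · have hlim : Tendsto (fun n : ℕ => T ω + 1 / ((n : ℝ≥0) + 1)) atTop (𝓝 (T ω)) := by
      simpa using (tendsto_const_nhds (x := T ω)).add
        (tendsto_one_div_add_atTop_nhds_zero_nat (𝕜 := ℝ≥0))
    refine tendsto_of_tendsto_of_tendsto_of_le_of_le tendsto_const_nhds hlim (fun n => ?_)
      (fun n => ?_)
    · change T ω ≤ _
      rw [le_div_iff₀ (by positivity)]
      exact (Nat.lt_floor_add_one _).le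
    · change _ ≤ T ω + 1 / ((n : ℝ≥0) + 1)
      rw [div_le_iff₀ (by positivity), add_mul, one_div, inv_mul_cancel₀ (by positivity)]
      gcongr
      exact Nat.floor_le (by positivity)
  · change T ω ≤ _
    rw [le_div_iff₀ (by positivity)]
    exact (Nat.lt_floor_add_one _).le

theorem onePoint_isClosed_compl_image_coe {X : Type*} [TopologicalSpace X] {U : Set X} (hU : IsOpen U) :
    IsClosed ((↑) '' U : Set (OnePoint X))ᶜ :=
  (OnePoint.isOpenEmbedding_coe.isOpenMap _ hU).isClosed_compl

theorem onePoint_exists_coe_eq_of_notMem_image {X : Type*} {U : Set X} {z : OnePoint X}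
    (hz : z ∉ ((↑) '' U : Set (OnePoint X))) (hz' : z ≠ OnePoint.infty) :
    ∃ y, y ∉ U ∧ z = (y : OnePoint X) := by
  induction z using OnePoint.rec with
  | infty => exact absurd rfl hz'
  | coe y => exact ⟨y, fun h => hz ⟨y, h, rfl⟩, rfl⟩

namespace HuntProcess

/-! ### Pathwise properties of exit times -/

section Paths

variable {X : Type*} [TopologicalSpace X] {Ω : Type*} [MeasurableSpace Ω] (𝔛 : HuntProcess X Ω)

theorem exitTime_le_of_mem {U : Set X} {ω : Ω} {t : ℝ≥0} {y : X} (hy : y ∉ U)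
    (h : 𝔛.Z t ω = (y : OnePoint X)) : 𝔛.exitTime U ω ≤ t :=
  sInf_le ⟨t, rfl, y, hy, h⟩

theorem exitTime_anti {U V : Set X} (h : U ⊆ V) (ω : Ω) : 𝔛.exitTime U ω ≤ 𝔛.exitTime V ω := by
  refine le_sInf ?_
  rintro _ ⟨t, rfl, y, hy, hty⟩
  exact 𝔛.exitTime_le_of_mem (fun hyU => hy (h hyU)) hty

/-- A finite exit time from an open set is attained. -/
theorem Z_exitTime {U : Set X} (hU : IsOpen U) {ω : Ω} (h : 𝔛.exitTime U ω ≠ ⊤) :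
    ∃ y, y ∉ U ∧ 𝔛.Z (𝔛.exitTime U ω).toNNReal ω = (y : OnePoint X) := by
  set S : Set ℝ≥0 := {t | ∃ y, y ∉ U ∧ 𝔛.Z t ω = (y : OnePoint X)} with hS
  have hτ : 𝔛.exitTime U ω = sInf ((↑) '' S : Set ℝ≥0∞) := by
    unfold exitTime
    congr 1
    ext r
    constructor
    · rintro ⟨t, rfl, y, hy, hty⟩
      exact ⟨t, ⟨y, hy, hty⟩, rfl⟩
    · rintro ⟨t, ⟨y, hy, hty⟩, rfl⟩
      exact ⟨t, rfl, y, hy, hty⟩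
  have hne : S.Nonempty := by
    by_contra hne
    rw [not_nonempty_iff_eq_empty] at hne
    exact h (by rw [hτ, hne]; simp)
  have hτ' : (𝔛.exitTime U ω).toNNReal = sInf S := by
    rw [hτ, sInf_image, ← ENNReal.coe_sInf hne, ENNReal.toNNReal_coe]
  rw [hτ']
  have hsub : S ⊆ Ici (sInf S) := fun t ht => csInf_le (OrderBot.bddBelow S) ht
  have : (𝓝[S] (sInf S)).NeBot :=
    mem_closure_iff_nhdsWithin_neBot.1 (csInf_mem_closure hne (OrderBot.bddBelow S))
  -- Times in `S` approach `sInf S` from the right, and the complement of `U` with the cemetery is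
  -- closed.
  have hmem : 𝔛.Z (sInf S) ω ∈ ((↑) '' U : Set (OnePoint X))ᶜ := by
    refine (onePoint_isClosed_compl_image_coe hU).mem_of_tendsto
      ((𝔛.path_right ω (sInf S)).mono hsub) ?_
    filter_upwards [self_mem_nhdsWithin] with t ht
    obtain ⟨y, hy, hty⟩ := ht
    rw [hty]
    rintro ⟨y', hy', h'⟩
    exact hy (OnePoint.coe_injective h' ▸ hy')
  -- A path dead at `sInf S` would be dead at every time of `S`.
  refine onePoint_exists_coe_eq_of_notMem_image hmem fun hinf => ?_
  obtain ⟨t, y, hy, hty⟩ := hne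
  have := 𝔛.trap ω _ t (hsub ⟨y, hy, hty⟩) hinf
  rw [hty] at this
  exact OnePoint.coe_ne_infty y this

theorem exitTime_le_iff {U : Set X} (hU : IsOpen U) {ω : Ω} {t : ℝ≥0} :
    𝔛.exitTime U ω ≤ t ↔ ∃ s ≤ t, ∃ y, y ∉ U ∧ 𝔛.Z s ω = (y : OnePoint X) := by
  constructor
  · intro h
    have hne : 𝔛.exitTime U ω ≠ ⊤ := (h.trans_lt ENNReal.coe_lt_top).ne
    refine ⟨_, ?_, 𝔛.Z_exitTime hU hne⟩
    rwa [← ENNReal.coe_le_coe, ENNReal.coe_toNNReal hne]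
  · rintro ⟨s, hs, y, hy, hsy⟩
    exact (𝔛.exitTime_le_of_mem hy hsy).trans (by exact_mod_cast hs)

/-- Any exit of the shifted path is an exit of the path itself. The inequality can be strict when
the path has left `U` before `r` and returned. -/
theorem exitTime_le_add_shift {U : Set X} (hU : IsOpen U) (r : ℝ≥0) (ω : Ω) :
    𝔛.exitTime U ω ≤ r + 𝔛.exitTime U (𝔛.θ r ω) := by
  by_cases h : 𝔛.exitTime U (𝔛.θ r ω) = ⊤
  · simp [h]
  · obtain ⟨y, hy, hty⟩ := 𝔛.Z_exitTime hU h
    rw [𝔛.shift] at hty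
    refine (𝔛.exitTime_le_of_mem hy hty).trans ?_
    rw [ENNReal.coe_add, ENNReal.coe_toNNReal h, add_comm]

theorem exitTime_eq_add_shift {U : Set X} (hU : IsOpen U) {r : ℝ≥0} {ω : Ω}
    (hr : r ≤ 𝔛.exitTime U ω) : 𝔛.exitTime U ω = r + 𝔛.exitTime U (𝔛.θ r ω) := by
  refine le_antisymm (𝔛.exitTime_le_add_shift hU r ω) ?_
  by_cases h : 𝔛.exitTime U ω = ⊤
  · simp [h]
  · obtain ⟨y, hy, hty⟩ := 𝔛.Z_exitTime hU h
    have hr' : r ≤ (𝔛.exitTime U ω).toNNReal := by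
      rwa [← ENNReal.coe_le_coe, ENNReal.coe_toNNReal h]
    have hs : 𝔛.Z ((𝔛.exitTime U ω).toNNReal - r) (𝔛.θ r ω) = (y : OnePoint X) := by
      rw [𝔛.shift, tsub_add_cancel_of_le hr', hty]
    refine (add_le_add_right (𝔛.exitTime_le_of_mem hy hs) _).trans ?_
    rw [← ENNReal.coe_add, add_tsub_cancel_of_le hr', ENNReal.coe_toNNReal h]

theorem stateAt_exitTime_shift {U : Set X} (hU : IsOpen U) {r : ℝ≥0} {ω : Ω}
    (hr : r ≤ 𝔛.exitTime U ω) :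
    stateAt 𝔛.Z (𝔛.exitTime U) (𝔛.θ r ω) = stateAt 𝔛.Z (𝔛.exitTime U) ω := by
  have h := 𝔛.exitTime_eq_add_shift hU hr
  by_cases h' : 𝔛.exitTime U (𝔛.θ r ω) = ⊤
  · have h'' : 𝔛.exitTime U ω = ⊤ := by rw [h, h']; simp
    simp only [stateAt, h', h'', if_true]
  · have h'' : 𝔛.exitTime U ω ≠ ⊤ := by
      rw [h]; exact ENNReal.add_ne_top.2 ⟨ENNReal.coe_ne_top, h'⟩
    simp only [stateAt, h', h'', if_false]
    rw [𝔛.shift, h, ENNReal.toNNReal_add ENNReal.coe_ne_top h', ENNReal.toNNReal_coe, add_comm]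

theorem stateAt_mem_range_iff {U : Set X} (hU : IsOpen U) {ω : Ω} :
    stateAt 𝔛.Z (𝔛.exitTime U) ω ∈ range ((↑) : X → OnePoint X) ↔ 𝔛.exitTime U ω ≠ ⊤ := by
  by_cases h : 𝔛.exitTime U ω = ⊤
  · simp [stateAt, h]
  · obtain ⟨y, -, hty⟩ := 𝔛.Z_exitTime hU h
    simp [stateAt, h, hty]

end Paths

end HuntProcess

/-! ### Measurability of exit times and the strong Markov property for functions -/

theorem measurable_stateAt {X Ω : Type*} [TopologicalSpace X] [T2Space X] [LocallyCompactSpace X]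
    [SecondCountableTopology X] [MeasurableSpace Ω] {Z : ℝ≥0 → Ω → OnePoint X}
    (hZ : ∀ t, Measurable (Z t)) (hr : ∀ ω t, ContinuousWithinAt (fun s => Z s ω) (Ici t) t)
    {T : Ω → ℝ≥0∞} (hT : Measurable T) : Measurable (stateAt Z T) := by
  classical
  have := onePoint_metrizableSpace X
  have h1 : Measurable fun ω => Z (T ω).toNNReal ω :=
    measurable_eval_randomTime hZ hr hT.ennreal_toNNReal
  have h2 : MeasurableSet {ω | T ω = ⊤} := hT (measurableSet_singleton ⊤)
  have h3 : Measurable fun ω => if T ω = ⊤ then OnePoint.infty else Z (T ω).toNNReal ω :=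
    Measurable.ite h2 measurable_const h1
  convert h3 using 2 with ω
  simp [stateAt]

namespace HuntProcess

/-- While alive, the path is continuous on a compact time interval, so it meets a closed set exactly
when its distance to that set becomes arbitrarily small along a countable dense set of times. The
σ-algebra `m` is left free to serve both the filtration and the σ-algebra generated by the process.
-/
theorem measurableSet_exitTime_le {X : Type*} [TopologicalSpace X] [T2Space X]
    [LocallyCompactSpace X] [SecondCountableTopology X] {Ω : Type*} (m : MeasurableSpace Ω)
    {mΩ : MeasurableSpace Ω} (𝔛 : HuntProcess X Ω) (hd : 𝔛.IsDiffusion) {U : Set X}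
    (hU : IsOpen U) (t : ℝ≥0) (hm : ∀ s ≤ t, Measurable[m] (𝔛.Z s)) :
    MeasurableSet[m] {ω | 𝔛.exitTime U ω ≤ t} := by
  have := onePoint_metrizableSpace X
  let _ := TopologicalSpace.metrizableSpaceMetric (OnePoint X)
  set F : Set (OnePoint X) := ((↑) '' U : Set (OnePoint X))ᶜ with hF
  have hFc : IsClosed F := onePoint_isClosed_compl_image_coe hU
  have hFne : F.Nonempty := ⟨OnePoint.infty, by simp [hF]⟩
  obtain ⟨D, hDc, hDd⟩ := TopologicalSpace.exists_countable_dense ℝ≥0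
  -- Survival up to `q` is imposed because the closed set `F` also contains the cemetery, and dying
  -- is not exiting.
  let E : ℝ≥0 → Set Ω := fun q => {ω | 𝔛.Z q ω ≠ OnePoint.infty} ∩
    ⋂ n : ℕ, ⋃ d ∈ D, {ω | Metric.infDist (𝔛.Z (min d q) ω) F < 1 / ((n : ℝ) + 1)}
  have hEm : ∀ q ≤ t, MeasurableSet[m] (E q) := by
    intro q hq
    refine MeasurableSet.inter (hm q hq (OnePoint.isClosed_infty.measurableSet.compl)) ?_
    refine MeasurableSet.iInter fun n => MeasurableSet.biUnion hDc fun d _ => ?_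
    exact ((Metric.continuous_infDist_pt F).measurable.comp
      (hm _ ((min_le_right d q).trans hq))) measurableSet_Iio
  have hE : ∀ q ω, ω ∈ E q ↔ 𝔛.Z q ω ≠ OnePoint.infty ∧
      ∃ s ≤ q, ∃ y, y ∉ U ∧ 𝔛.Z s ω = (y : OnePoint X) := by
    intro q ω
    refine and_congr_right fun hq => ?_
    have halive : ∀ s ≤ q, 𝔛.Z s ω ≠ OnePoint.infty := fun s hs h => hq (𝔛.trap ω s q hs h)
    have hcont : ContinuousOn (fun s => 𝔛.Z s ω) (Icc 0 q) :=
      (hd ω).mono fun s hs => halive s hs.2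
    have hg : ContinuousOn (fun s => Metric.infDist (𝔛.Z s ω) F) (Icc 0 q) :=
      (Metric.continuous_infDist_pt F).comp_continuousOn hcont
    have hh : Continuous fun d => Metric.infDist (𝔛.Z (min d q) ω) F :=
      hg.comp_continuous (f := fun d => min d q) (continuous_id.min continuous_const)
        fun d => ⟨zero_le, min_le_right d q⟩
    simp only [mem_iInter, mem_iUnion, mem_ofPred_eq, exists_prop]
    constructor
    · intro H
      obtain ⟨s, hs, hmin⟩ := isCompact_Icc.exists_isMinOn ⟨0, left_mem_Icc.2 zero_le⟩ hg
      have h0 : Metric.infDist (𝔛.Z s ω) F = 0 := by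
        refine le_antisymm (le_of_forall_pos_le_add fun ε hε => ?_) Metric.infDist_nonneg
        obtain ⟨n, hn⟩ := exists_nat_one_div_lt hε
        obtain ⟨d, -, hd'⟩ := H n
        have h1 := hmin (show min d q ∈ Icc 0 q from ⟨zero_le, min_le_right d q⟩)
        simp only [mem_ofPred_eq] at h1
        linarith
      have hsF : 𝔛.Z s ω ∈ F := (hFc.mem_iff_infDist_zero hFne).2 h0
      exact ⟨s, hs.2, onePoint_exists_coe_eq_of_notMem_image hsF (halive s hs.2)⟩
    · rintro ⟨s, hs, y, hy, hsy⟩ n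
      have hsF : Metric.infDist (𝔛.Z (min s q) ω) F = 0 := by
        rw [min_eq_left hs]
        refine Metric.infDist_zero_of_mem ?_
        rw [hsy]
        rintro ⟨y', hy', h'⟩
        exact hy (OnePoint.coe_injective h' ▸ hy')
      obtain ⟨d, hd', hdD⟩ := hDd.exists_mem_open
        (isOpen_Iio.preimage hh : IsOpen ((fun d => Metric.infDist (𝔛.Z (min d q) ω) F) ⁻¹'
          Iio (1 / ((n : ℝ) + 1)))) ⟨s, by
            simp only [mem_preimage, hsF, mem_Iio]; positivity⟩
      exact ⟨d, hd', hdD⟩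
  -- A path may exit at `s < t` and die before `t`; by right-continuity it is still alive at some `d
  -- ∈ D` just after `s`.
  have heq : {ω | 𝔛.exitTime U ω ≤ t} = E t ∪ ⋃ d ∈ D ∩ Iic t, E d := by
    ext ω
    simp only [mem_ofPred_eq, mem_union, mem_iUnion, exists_prop, hE, 𝔛.exitTime_le_iff hU]
    constructor
    · rintro ⟨s, hs, y, hy, hsy⟩
      rcases hs.eq_or_lt with rfl | hlt
      · exact Or.inl ⟨by rw [hsy]; exact OnePoint.coe_ne_infty y, s, le_rfl, y, hy, hsy⟩
      · right
        have hopen : {z : OnePoint X | z ≠ OnePoint.infty} ∈ 𝓝 (𝔛.Z s ω) :=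
          OnePoint.isClosed_infty.isOpen_compl.mem_nhds
            (by rw [hsy]; exact OnePoint.coe_ne_infty y)
        have hev := (𝔛.path_right ω s).mono Ioi_subset_Ici_self hopen
        obtain ⟨u, hu, hus⟩ := mem_nhdsGT_iff_exists_Ioo_subset.1 hev
        obtain ⟨d, hdD, hd1, hd2⟩ := hDd.exists_between (lt_min hlt hu)
        exact ⟨d, ⟨hdD, (hd2.trans_le (min_le_left _ _)).le⟩,
          hus ⟨hd1, hd2.trans_le (min_le_right _ _)⟩, s, hd1.le, y, hy, hsy⟩
    · rintro (⟨-, s, hs, h⟩ | ⟨d, ⟨-, hdt⟩, -, s, hs, h⟩)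
      · exact ⟨s, hs, h⟩
      · exact ⟨s, hs.trans hdt, h⟩
  rw [heq]
  exact (hEm t le_rfl).union
    (MeasurableSet.biUnion (hDc.mono inter_subset_left) fun d hd => hEm d hd.2)

section Measurability

variable {X : Type*} [TopologicalSpace X] {Ω : Type*} [mΩ : MeasurableSpace Ω]
  (𝔛 : HuntProcess X Ω)

/-- The σ-algebra generated by the process. -/
abbrev pathSigma : MeasurableSpace Ω :=
  ⨆ t, MeasurableSpace.comap (𝔛.Z t) (onePointMeasurableSpace X)

theorem measurable_Z_pathSigma (t : ℝ≥0) : Measurable[𝔛.pathSigma] (𝔛.Z t) :=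
  measurable_iff_comap_le.2 (le_iSup (fun t => MeasurableSpace.comap (𝔛.Z t) _) t)

theorem measurable_Z (t : ℝ≥0) : Measurable (𝔛.Z t) :=
  (𝔛.adapted t).mono (𝔛.𝓜.le t) le_rfl

theorem pathSigma_le : 𝔛.pathSigma ≤ mΩ :=
  iSup_le fun t => measurable_iff_comap_le.1 (𝔛.measurable_Z t)

/-- Measurable dependence on the starting point is known only for events of the process, hence the
passage to the trimmed measures. -/
theorem measurable_lintegral_P {f : Ω → ℝ≥0∞} (hf : Measurable[𝔛.pathSigma] f) :
    Measurable fun z => ∫⁻ ω, f ω ∂(𝔛.P z) := by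
  have hκ : @Measurable _ _ _ (@Measure.instMeasurableSpace Ω 𝔛.pathSigma)
      fun z => (𝔛.P z).trim 𝔛.pathSigma_le := by
    refine @Measure.measurable_of_measurable_coe _ _ 𝔛.pathSigma _ _ fun A hA => ?_
    simp only [trim_measurableSet_eq 𝔛.pathSigma_le hA]
    exact 𝔛.measurable_P A hA
  have := (@Measure.measurable_lintegral _ 𝔛.pathSigma f hf).comp hκ
  convert this using 2 with z
  exact (lintegral_trim 𝔛.pathSigma_le hf).symm

variable [T2Space X] [LocallyCompactSpace X] [SecondCountableTopology X]

theorem isStoppingTime_exitTime (hd : 𝔛.IsDiffusion) {U : Set X} (hU : IsOpen U) :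
    IsStoppingTime 𝔛.𝓜 (𝔛.exitTime U) := fun t =>
  measurableSet_exitTime_le (𝔛.𝓜 t) 𝔛 hd hU t fun s hs =>
    (𝔛.adapted s).mono (𝔛.𝓜.mono hs) le_rfl

theorem measurable_exitTime_pathSigma (hd : 𝔛.IsDiffusion) {U : Set X} (hU : IsOpen U) :
    Measurable[𝔛.pathSigma] (𝔛.exitTime U) := by
  refine @measurable_of_Iic ℝ≥0∞ Ω _ _ _ 𝔛.pathSigma _ _ _ _ fun a => ?_
  induction a using ENNReal.recTopCoe with
  | top => simp
  | coe t =>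
    exact measurableSet_exitTime_le _ 𝔛 hd hU t fun s _ => 𝔛.measurable_Z_pathSigma s

theorem measurable_exitTime (hd : 𝔛.IsDiffusion) {U : Set X} (hU : IsOpen U) :
    Measurable (𝔛.exitTime U) :=
  (𝔛.measurable_exitTime_pathSigma hd hU).mono 𝔛.pathSigma_le le_rfl

theorem measurable_shift {T : Ω → ℝ≥0∞} (hT : Measurable T) :
    Measurable[mΩ, 𝔛.pathSigma] fun ω => 𝔛.θ (T ω).toNNReal ω := by
  have := onePoint_metrizableSpace X
  rw [measurable_iff_comap_le, MeasurableSpace.comap_iSup]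
  refine iSup_le fun s => ?_
  rw [MeasurableSpace.comap_comp, ← measurable_iff_comap_le]
  have h := measurable_eval_randomTime 𝔛.measurable_Z 𝔛.path_right
    (hT.ennreal_toNNReal.const_add s)
  convert h using 2 with ω
  exact 𝔛.shift s _ ω

/-- The strong Markov property for positive functions. -/
theorem lintegral_shift {T : Ω → ℝ≥0∞} (hT : IsStoppingTime 𝔛.𝓜 T) (hTm : Measurable T)
    {f : Ω → ℝ≥0∞} (hf : Measurable[𝔛.pathSigma] f) (x : OnePoint X) :
    ∫⁻ ω in {ω | T ω ≠ ⊤}, f (𝔛.θ (T ω).toNNReal ω) ∂(𝔛.P x) =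
      ∫⁻ ω in {ω | T ω ≠ ⊤}, ∫⁻ ω', f ω' ∂(𝔛.P (stateAt 𝔛.Z T ω)) ∂(𝔛.P x) := by
  have hst := measurable_stateAt 𝔛.measurable_Z 𝔛.path_right hTm
  have hθ := 𝔛.measurable_shift hTm
  have hPst : ∀ g : Ω → ℝ≥0∞, Measurable[𝔛.pathSigma] g →
      Measurable fun ω => ∫⁻ ω', g ω' ∂(𝔛.P (stateAt 𝔛.Z T ω)) :=
    fun g hg => (𝔛.measurable_lintegral_P hg).comp hst
  have hgθ : ∀ g : Ω → ℝ≥0∞, Measurable[𝔛.pathSigma] g →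
      Measurable fun ω => g (𝔛.θ (T ω).toNNReal ω) := fun g hg => hg.comp hθ
  -- For indicators this is the strong Markov property with `Λ = univ`; sums and monotone limits do
  -- the rest.
  refine @Measurable.ennreal_induction Ω 𝔛.pathSigma (fun f =>
    ∫⁻ ω in {ω | T ω ≠ ⊤}, f (𝔛.θ (T ω).toNNReal ω) ∂(𝔛.P x) =
      ∫⁻ ω in {ω | T ω ≠ ⊤}, ∫⁻ ω', f ω' ∂(𝔛.P (stateAt 𝔛.Z T ω)) ∂(𝔛.P x)) ?_ ?_ ?_ f hf
  · intro c A hA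
    have hA' : MeasurableSet A := 𝔛.pathSigma_le A hA
    have hpre : MeasurableSet {ω | 𝔛.θ (T ω).toNNReal ω ∈ A} := hθ hA
    have hl : ∀ ω, A.indicator (fun _ => c) (𝔛.θ (T ω).toNNReal ω) =
        {ω | 𝔛.θ (T ω).toNNReal ω ∈ A}.indicator (fun _ => c) ω := fun ω => rfl
    simp only [hl]
    rw [lintegral_indicator_const hpre, Measure.restrict_apply hpre]
    simp only [lintegral_indicator_const hA']
    have hPA : Measurable fun ω => 𝔛.P (stateAt 𝔛.Z T ω) A := (𝔛.measurable_P A hA).comp hst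
    rw [lintegral_const_mul _ hPA]
    have hsm := 𝔛.strongMarkov T hT x univ A MeasurableSet.univ hA
    simp only [mem_univ, true_and] at hsm
    rw [← hsm]
    congr 2
    ext ω
    exact and_comm
  · intro f g _ hf hg ihf ihg
    have hf' : Measurable f := hf.mono 𝔛.pathSigma_le le_rfl
    simp only [Pi.add_apply]
    rw [lintegral_add_left (hgθ f hf),
      ihf, ihg]
    simp only [lintegral_add_left hf']
    rw [lintegral_add_left (hPst f hf)]
  · intro f hf hmono ih
    have hf' : ∀ n, Measurable (f n) := fun n => (hf n).mono 𝔛.pathSigma_le le_rfl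
    change ∫⁻ ω in {ω | T ω ≠ ⊤}, ⨆ n, f n (𝔛.θ (T ω).toNNReal ω) ∂(𝔛.P x) = _
    rw [lintegral_iSup (fun n => hgθ _ (hf n)) (fun i j hij ω => hmono hij _)]
    simp only [lintegral_iSup hf' hmono]
    rw [lintegral_iSup (fun n => hPst _ (hf n))
      (fun i j hij ω => lintegral_mono (hmono hij))]
    exact iSup_congr ih

end Measurability

end HuntProcess

theorem measurableEmbedding_onePoint_coe {X : Type*} [TopologicalSpace X]
    [MeasurableSpace X] [BorelSpace X] :
    MeasurableEmbedding ((↑) : X → OnePoint X) :=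
  OnePoint.isOpenEmbedding_coe.measurableEmbedding

namespace HuntProcess

/-! ### Exit kernels and their composition identities -/

section ExitKernel

variable {X : Type*} [TopologicalSpace X] {Ω : Type*} [mΩ : MeasurableSpace Ω]
  (𝔛 : HuntProcess X Ω)

theorem exitTime_eq_zero_ae {U : Set X} {x : X} (hx : x ∉ U) :
    ∀ᵐ ω ∂(𝔛.P x), 𝔛.exitTime U ω = 0 := by
  filter_upwards [𝔛.start x] with ω hω
  exact nonpos_iff_eq_zero.1 (by simpa using 𝔛.exitTime_le_of_mem hx hω)

theorem expectedExitTime_eq_zero {U : Set X} {x : X} (hx : x ∉ U) :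
    𝔛.expectedExitTime U x = 0 := by
  unfold expectedExitTime
  rw [lintegral_congr_ae (𝔛.exitTime_eq_zero_ae hx)]
  simp

theorem exitTime_pos_ae {U : Set X} (hU : IsOpen U) {x : X} (hx : x ∈ U) :
    ∀ᵐ ω ∂(𝔛.P x), 0 < 𝔛.exitTime U ω := by
  filter_upwards [𝔛.start x] with ω hω
  rw [pos_iff_ne_zero]
  intro h
  obtain ⟨y, hy, hty⟩ := 𝔛.Z_exitTime hU (h ▸ ENNReal.zero_ne_top)
  rw [h, ENNReal.toNNReal_zero, hω] at hty
  exact hy (OnePoint.coe_injective hty ▸ hx)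

/-- `τ_U ≤ τ_W + τ_U ∘ θ_{τ_W}` for arbitrary open sets. -/
theorem exitTime_le_add_indicator (U W : Set X) (hU : IsOpen U) (ω : Ω) :
    𝔛.exitTime U ω ≤ 𝔛.exitTime W ω + {ω | 𝔛.exitTime W ω ≠ ⊤}.indicator
      (fun ω => 𝔛.exitTime U (𝔛.θ (𝔛.exitTime W ω).toNNReal ω)) ω := by
  by_cases h : 𝔛.exitTime W ω = ⊤
  · simp [h]
  · rw [indicator_of_mem (by exact h)]
    have := 𝔛.exitTime_le_add_shift hU (𝔛.exitTime W ω).toNNReal ω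
    rwa [ENNReal.coe_toNNReal h] at this

/-- No exit from `V` precedes the exit from `W`, so the shift by `τ_W` loses nothing; the indicator
covers `τ_W = ∞`, which forces `τ_V = ∞`. -/
theorem exitTime_eq_add_indicator {W V : Set X} (hV : IsOpen V) (hWV : W ⊆ V) (ω : Ω) :
    𝔛.exitTime V ω = 𝔛.exitTime W ω + {ω | 𝔛.exitTime W ω ≠ ⊤}.indicator
      (fun ω => 𝔛.exitTime V (𝔛.θ (𝔛.exitTime W ω).toNNReal ω)) ω := by
  have hle := 𝔛.exitTime_anti hWV ω
  by_cases h : 𝔛.exitTime W ω = ⊤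
  · rw [h, top_le_iff] at hle
    simp [h, hle]
  · rw [indicator_of_mem (by exact h)]
    have := 𝔛.exitTime_eq_add_shift hV (r := (𝔛.exitTime W ω).toNNReal) (ω := ω)
      (by rwa [ENNReal.coe_toNNReal h])
    rwa [ENNReal.coe_toNNReal h] at this

variable [T2Space X] [LocallyCompactSpace X] [SecondCountableTopology X]

theorem measurable_expectedExitTime_onePoint (hd : 𝔛.IsDiffusion) {U : Set X} (hU : IsOpen U) :
    Measurable fun z : OnePoint X => ∫⁻ ω, 𝔛.exitTime U ω ∂(𝔛.P z) :=
  𝔛.measurable_lintegral_P (𝔛.measurable_exitTime_pathSigma hd hU)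

theorem expectedExitTime_pos (hd : 𝔛.IsDiffusion) {U : Set X} (hU : IsOpen U) {x : X}
    (hx : x ∈ U) : 0 < 𝔛.expectedExitTime U x := by
  have := 𝔛.isProbabilityMeasure x
  rw [pos_iff_ne_zero]
  intro h
  have h0 := (lintegral_eq_zero_iff (𝔛.measurable_exitTime hd hU)).1 h
  obtain ⟨ω, h1, h2⟩ := (h0.and (𝔛.exitTime_pos_ae hU hx)).exists
  exact h2.ne' h1

theorem measurable_stateAt_exitTime (hd : 𝔛.IsDiffusion) {U : Set X} (hU : IsOpen U) :
    Measurable (stateAt 𝔛.Z (𝔛.exitTime U)) :=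
  measurable_stateAt 𝔛.measurable_Z 𝔛.path_right (𝔛.measurable_exitTime hd hU)

theorem measurable_stateAt_exitTime_pathSigma (hd : 𝔛.IsDiffusion) {U : Set X} (hU : IsOpen U) :
    Measurable[𝔛.pathSigma] (stateAt 𝔛.Z (𝔛.exitTime U)) :=
  @measurable_stateAt _ _ _ _ _ _ 𝔛.pathSigma _ 𝔛.measurable_Z_pathSigma 𝔛.path_right _
    (𝔛.measurable_exitTime_pathSigma hd hU)

theorem measurableSet_exitTime_ne_top (hd : 𝔛.IsDiffusion) {U : Set X} (hU : IsOpen U) :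
    MeasurableSet {ω | 𝔛.exitTime U ω ≠ ⊤} :=
  (𝔛.measurable_exitTime hd hU (measurableSet_singleton ⊤)).compl

variable [MeasurableSpace X] [BorelSpace X]

theorem exitKernel_apply (hd : 𝔛.IsDiffusion) {U : Set X} (hU : IsOpen U) (x : X) {B : Set X}
    (hB : MeasurableSet B) :
    𝔛.exitKernel U x B = 𝔛.P x {ω | stateAt 𝔛.Z (𝔛.exitTime U) ω ∈ ((↑) '' B : Set (OnePoint X))} := by
  unfold exitKernel
  rw [measurableEmbedding_onePoint_coe.comap_apply,
    Measure.map_apply (𝔛.measurable_stateAt_exitTime hd hU)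
      (measurableEmbedding_onePoint_coe.measurableSet_image.2 hB)]
  rfl

/-- The exit state lies in `X` exactly when the exit time is finite. Taking `g` on `OnePoint X`
matches the right side of the strong Markov property. -/
theorem lintegral_exitKernel (hd : 𝔛.IsDiffusion) {U : Set X} (hU : IsOpen U) (x : X)
    {g : OnePoint X → ℝ≥0∞} (hg : Measurable g) :
    ∫⁻ y, g y ∂(𝔛.exitKernel U x) =
      ∫⁻ ω in {ω | 𝔛.exitTime U ω ≠ ⊤}, g (stateAt 𝔛.Z (𝔛.exitTime U) ω) ∂(𝔛.P x) := by
  have hst := 𝔛.measurable_stateAt_exitTime hd hU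
  unfold exitKernel
  rw [← measurableEmbedding_onePoint_coe.lintegral_map (f := g),
    measurableEmbedding_onePoint_coe.map_comap,
    Measure.restrict_map hst measurableEmbedding_onePoint_coe.measurableSet_range,
    lintegral_map hg hst]
  congr 2
  ext ω
  exact 𝔛.stateAt_mem_range_iff hU

theorem measurable_exitKernel (hd : 𝔛.IsDiffusion) {U : Set X} (hU : IsOpen U) :
    Measurable (𝔛.exitKernel U) := by
  refine Measure.measurable_of_measurable_coe _ fun B hB => ?_
  simp only [𝔛.exitKernel_apply hd hU _ hB]
  exact (𝔛.measurable_P _ (𝔛.measurable_stateAt_exitTime_pathSigma hd hU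
    (measurableEmbedding_onePoint_coe.measurableSet_image.2 hB))).comp
    OnePoint.continuous_coe.measurable

theorem exitKernel_eq_dirac (hd : 𝔛.IsDiffusion) {U : Set X} (hU : IsOpen U) {x : X}
    (hx : x ∉ U) : 𝔛.exitKernel U x = Measure.dirac x := by
  have := 𝔛.isProbabilityMeasure x
  ext B hB
  rw [𝔛.exitKernel_apply hd hU x hB, Measure.dirac_apply' x hB]
  have hae : ∀ᵐ ω ∂(𝔛.P x), stateAt 𝔛.Z (𝔛.exitTime U) ω = (x : OnePoint X) := by
    filter_upwards [𝔛.start x, 𝔛.exitTime_eq_zero_ae hx] with ω h1 h2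
    simp [stateAt, h2, h1]
  by_cases hxB : x ∈ B
  · rw [indicator_of_mem hxB, Pi.one_apply, ← measure_univ (μ := 𝔛.P x)]
    refine measure_congr (eventuallyEq_univ.2 ?_)
    filter_upwards [hae] with ω h
    simp [h, hxB]
  · rw [indicator_of_notMem hxB]
    refine measure_eq_zero_iff_ae_notMem.2 ?_
    filter_upwards [hae] with ω h
    simp [h, hxB]

/-- At the exit time from an open set a path which started in it is at its boundary. -/
theorem exitKernel_compl_frontier (hd : 𝔛.IsDiffusion) {U : Set X} (hU : IsOpen U) {x : X}
    (hx : x ∈ U) : 𝔛.exitKernel U x (frontier U)ᶜ = 0 := by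
  rw [𝔛.exitKernel_apply hd hU x isClosed_frontier.measurableSet.compl]
  refine measure_mono_null (fun ω hω => ?_) (ae_iff.1 (𝔛.exitTime_pos_ae hU hx))
  obtain ⟨y, hy, hyω⟩ := hω
  intro hpos
  have hne : 𝔛.exitTime U ω ≠ ⊤ := (𝔛.stateAt_mem_range_iff hU).1 ⟨y, hyω⟩
  obtain ⟨y', hy', hty⟩ := 𝔛.Z_exitTime hU hne
  have hst : stateAt 𝔛.Z (𝔛.exitTime U) ω = (y' : OnePoint X) := by simp [stateAt, hne, hty]
  rw [hst] at hyω
  obtain rfl := OnePoint.coe_injective hyω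
  refine hy ⟨?_, by rwa [hU.interior_eq]⟩
  set τ := (𝔛.exitTime U ω).toNNReal with hτ
  have hτc : 𝔛.exitTime U ω = τ := (ENNReal.coe_toNNReal hne).symm
  have hτpos : 0 < τ := by rw [hτc] at hpos; exact_mod_cast hpos
  have halive : ∀ s ≤ τ, 𝔛.Z s ω ≠ OnePoint.infty := fun s hs h =>
    OnePoint.coe_ne_infty y (hty ▸ 𝔛.trap ω s τ hs h)
  -- Before `τ` the path is in `U`, so left continuity at `τ` puts the exit point in the closure of
  -- `U`.
  have hcont : Tendsto (fun s => 𝔛.Z s ω) (𝓝[<] τ) (𝓝 (y : OnePoint X)) := by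
    rw [← hty]
    exact ((hd ω) τ (halive τ le_rfl)).mono fun s hs => halive s (le_of_lt hs)
  have : (𝓝[<] τ).NeBot := nhdsLT_neBot_of_exists_lt ⟨0, hτpos⟩
  have hcl : (y : OnePoint X) ∈ closure ((↑) '' U : Set (OnePoint X)) := by
    refine mem_closure_of_tendsto hcont ?_
    filter_upwards [self_mem_nhdsWithin] with s hs
    by_contra hsU
    obtain ⟨z, hz, hsz⟩ := onePoint_exists_coe_eq_of_notMem_image hsU (halive s (le_of_lt hs))
    have := 𝔛.exitTime_le_of_mem hz hsz
    rw [hτc, ENNReal.coe_le_coe] at this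
    exact absurd hs (not_lt.2 this)
  rw [OnePoint.isOpenEmbedding_coe.isInducing.closure_eq_preimage_closure_image]
  exact hcl

/-- A finite expectation makes the exit time almost surely finite, so no mass is lost to the
cemetery. -/
theorem exitKernel_univ (hd : 𝔛.IsDiffusion) {U : Set X} (hU : IsOpen U) {x : X}
    (h : 𝔛.expectedExitTime U x ≠ ⊤) : 𝔛.exitKernel U x univ = 1 := by
  have := 𝔛.isProbabilityMeasure x
  rw [𝔛.exitKernel_apply hd hU x MeasurableSet.univ, ← measure_univ (μ := 𝔛.P x)]
  refine measure_congr (eventuallyEq_univ.2 ?_)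
  filter_upwards [ae_lt_top (𝔛.measurable_exitTime hd hU) h] with ω hω
  simp only [image_univ]
  exact (𝔛.stateAt_mem_range_iff hU).2 hω.ne

theorem setLIntegral_exitTime_shift (hd : 𝔛.IsDiffusion) {U W : Set X} (hU : IsOpen U)
    (hW : IsOpen W) (x : X) :
    ∫⁻ ω, {ω | 𝔛.exitTime W ω ≠ ⊤}.indicator
      (fun ω => 𝔛.exitTime U (𝔛.θ (𝔛.exitTime W ω).toNNReal ω)) ω ∂(𝔛.P x) =
      ∫⁻ y, 𝔛.expectedExitTime U y ∂(𝔛.exitKernel W x) := by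
  rw [lintegral_indicator (𝔛.measurableSet_exitTime_ne_top hd hW),
    𝔛.lintegral_shift (𝔛.isStoppingTime_exitTime hd hW) (𝔛.measurable_exitTime hd hW)
      (𝔛.measurable_exitTime_pathSigma hd hU),
    ← 𝔛.lintegral_exitKernel hd hW x (𝔛.measurable_expectedExitTime_onePoint hd hU)]
  rfl

/-- `p_U ≤ p_W + H_W p_U`. -/
theorem expectedExitTime_le (hd : 𝔛.IsDiffusion) {U W : Set X} (hU : IsOpen U)
    (hW : IsOpen W) (x : X) :
    𝔛.expectedExitTime U x ≤
      𝔛.expectedExitTime W x + ∫⁻ y, 𝔛.expectedExitTime U y ∂(𝔛.exitKernel W x) := by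
  rw [← 𝔛.setLIntegral_exitTime_shift hd hU hW]
  unfold expectedExitTime
  rw [← lintegral_add_left (𝔛.measurable_exitTime hd hW)]
  exact lintegral_mono fun ω => 𝔛.exitTime_le_add_indicator U W hU ω

/-- `p_V = p_W + H_W p_V` if `W ⊆ V`. -/
theorem expectedExitTime_eq (hd : 𝔛.IsDiffusion) {W V : Set X} (hW : IsOpen W)
    (hV : IsOpen V) (hWV : W ⊆ V) (x : X) :
    𝔛.expectedExitTime V x =
      𝔛.expectedExitTime W x + ∫⁻ y, 𝔛.expectedExitTime V y ∂(𝔛.exitKernel W x) := by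
  rw [← 𝔛.setLIntegral_exitTime_shift hd hV hW]
  unfold expectedExitTime
  rw [← lintegral_add_left (𝔛.measurable_exitTime hd hW)]
  exact lintegral_congr fun ω => 𝔛.exitTime_eq_add_indicator hV hWV ω

/-- `H_W H_V = H_V` if `W ⊆ V`. -/
theorem lintegral_exitKernel_exitKernel (hd : 𝔛.IsDiffusion) {W V : Set X} (hW : IsOpen W)
    (hV : IsOpen V) (hWV : W ⊆ V) (x : X) {B : Set X} (hB : MeasurableSet B) :
    ∫⁻ y, 𝔛.exitKernel V y B ∂(𝔛.exitKernel W x) = 𝔛.exitKernel V x B := by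
  set A : Set Ω := {ω | stateAt 𝔛.Z (𝔛.exitTime V) ω ∈ ((↑) '' B : Set (OnePoint X))} with hA
  have hAm : MeasurableSet[𝔛.pathSigma] A := 𝔛.measurable_stateAt_exitTime_pathSigma hd hV
    (measurableEmbedding_onePoint_coe.measurableSet_image.2 hB)
  simp only [𝔛.exitKernel_apply hd hV _ hB]
  rw [𝔛.lintegral_exitKernel hd hW x (g := fun z => 𝔛.P z A) (𝔛.measurable_P A hAm)]
  have hsm := 𝔛.strongMarkov _ (𝔛.isStoppingTime_exitTime hd hW) x univ A MeasurableSet.univ hAm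
  simp only [mem_univ, true_and] at hsm
  rw [← hsm]
  congr 1
  ext ω
  have hle := 𝔛.exitTime_anti hWV ω
  -- Since `τ_W ≤ τ_V`, shifting by `τ_W` does not change the exit state from `V`.
  have hshift : 𝔛.exitTime W ω ≠ ⊤ → (𝔛.θ (𝔛.exitTime W ω).toNNReal ω ∈ A ↔ ω ∈ A) := by
    intro h
    simp only [hA, mem_ofPred_eq]
    rw [𝔛.stateAt_exitTime_shift hV (by rwa [ENNReal.coe_toNNReal h])]
  constructor
  · rintro ⟨h, h'⟩
    exact (hshift h).1 h'
  · intro h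
    have hVt : 𝔛.exitTime V ω ≠ ⊤ :=
      (𝔛.stateAt_mem_range_iff hV).1 (image_subset_range _ _ h)
    have hWt := ne_top_of_le_ne_top hVt hle
    exact ⟨hWt, (hshift hWt).2 h⟩

end ExitKernel

end HuntProcess

/-! ### Hyperharmonicity of positive functions -/

theorem erealIntegral_coe_ennreal {X : Type*} [TopologicalSpace X] [MeasurableSpace X]
    (μ : Measure X) (g : X → ℝ≥0∞) :
    erealIntegral μ (fun x => (g x : EReal)) = ((∫⁻ x, g x ∂μ : ℝ≥0∞) : EReal) := by
  have h : ∀ x, (-(g x : EReal)).toENNReal = 0 := fun x =>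
    EReal.toENNReal_of_nonpos (EReal.neg_le.1 (by simpa using EReal.coe_ennreal_nonneg (g x)))
  simp only [erealIntegral, h, EReal.toENNReal_coe]
  simp

theorem isLocallyHyperharmonic_coe_ennreal {X : Type*} [TopologicalSpace X] [MeasurableSpace X]
    {H : Set X → X → Measure X} {𝓦 : X → Set (Set X)} {U : Set X} {g : X → ℝ≥0∞}
    (hg : Continuous g) (h : ∀ x ∈ U, ∀ W ∈ 𝓦 x, ∫⁻ y, g y ∂(H W x) ≤ g x) :
    IsLocallyHyperharmonic H 𝓦 U (fun x => (g x : EReal)) := by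
  refine ⟨(continuous_coe_ennreal_ereal.comp hg).lowerSemicontinuous.lowerSemicontinuousOn _,
    fun x _ => EReal.coe_ennreal_ne_bot _, fun x hx W hW => ?_⟩
  rw [erealIntegral_coe_ennreal]
  exact EReal.coe_ennreal_le_coe_ennreal_iff.2 (h x hx W hW)

namespace HuntProcess

/-! ### Continuity of expected exit times and of exit kernel integrals -/

section Continuity

variable {X : Type*} [TopologicalSpace X] {Ω : Type*} [mΩ : MeasurableSpace Ω]
  {𝔛 : HuntProcess X Ω}

theorem D1.expectedExitTime_ne_top {V : Set X} (h1 : 𝔛.D1 V) (x : X) :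
    𝔛.expectedExitTime V x ≠ ⊤ := by
  by_cases hx : x ∈ V
  · exact h1.2.1 x hx
  · simp [𝔛.expectedExitTime_eq_zero hx]

/-- Off `V` the function vanishes, and `D1` makes its limit from inside zero at the boundary, so the
two pieces glue. -/
theorem D1.continuous_expectedExitTime {V : Set X} (hV : IsOpen V) (h1 : 𝔛.D1 V) :
    Continuous (𝔛.expectedExitTime V) := by
  rw [continuous_iff_continuousAt]
  intro x
  by_cases hx : x ∈ V
  · exact h1.2.2.1.continuousAt (hV.mem_nhds hx)
  · have hcompl : Tendsto (𝔛.expectedExitTime V) (𝓝[Vᶜ] x) (𝓝 0) :=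
      tendsto_const_nhds.congr' (by
        filter_upwards [self_mem_nhdsWithin] with y hy
        exact (𝔛.expectedExitTime_eq_zero hy).symm)
    have hin : Tendsto (𝔛.expectedExitTime V) (𝓝[V] x) (𝓝 0) := by
      by_cases hx' : x ∈ closure V
      · exact h1.2.2.2 x ⟨hx', by rwa [hV.interior_eq]⟩
      · rw [notMem_closure_iff_nhdsWithin_eq_bot.1 hx']
        exact tendsto_bot
    rw [ContinuousAt, 𝔛.expectedExitTime_eq_zero hx, ← nhdsWithin_univ, ← union_compl_self V,
      nhdsWithin_union]
    exact hin.sup hcompl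

theorem D1.exists_bound_frontier {V : Set X} (h1 : 𝔛.D1 V) {f : X → ℝ} (hf : Continuous f) :
    ∃ C, 0 ≤ C ∧ ∀ y ∈ frontier V, |f y| ≤ C := by
  obtain ⟨C, hC⟩ := (h1.1.of_isClosed_subset isClosed_frontier
    frontier_subset_closure).exists_bound_of_continuousOn hf.continuousOn
  exact ⟨max C 0, le_max_right _ _, fun y hy => (hC y hy).trans (le_max_left _ _)⟩

variable [T2Space X] [LocallyCompactSpace X] [SecondCountableTopology X]
  [MeasurableSpace X] [BorelSpace X]

theorem D1.isProbabilityMeasure_exitKernel (hd : 𝔛.IsDiffusion) {V : Set X} (hV : IsOpen V)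
    (h1 : 𝔛.D1 V) (x : X) : IsProbabilityMeasure (𝔛.exitKernel V x) :=
  ⟨𝔛.exitKernel_univ hd hV (h1.expectedExitTime_ne_top x)⟩

theorem ae_mem_frontier_exitKernel (hd : 𝔛.IsDiffusion) {V : Set X} (hV : IsOpen V)
    {x : X} (hx : x ∈ V) : ∀ᵐ y ∂(𝔛.exitKernel V x), y ∈ frontier V :=
  mem_ae_iff.2 (𝔛.exitKernel_compl_frontier hd hV hx)

theorem D1.integrable_exitKernel (hd : 𝔛.IsDiffusion) {V : Set X} (hV : IsOpen V)
    (h1 : 𝔛.D1 V) {f : X → ℝ} (hf : Continuous f) (x : X) :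
    Integrable f (𝔛.exitKernel V x) := by
  have := h1.isProbabilityMeasure_exitKernel hd hV x
  by_cases hx : x ∈ V
  · obtain ⟨C, -, hC⟩ := h1.exists_bound_frontier hf
    refine Integrable.of_bound hf.measurable.aestronglyMeasurable C ?_
    filter_upwards [ae_mem_frontier_exitKernel hd hV hx] with y hy
    exact hC y hy
  · rw [𝔛.exitKernel_eq_dirac hd hV hx]
    exact integrable_dirac' hf.measurable.stronglyMeasurable (by simp)

/-- Inside `V` the measures live on the compact boundary, where `f` is bounded, so the second half
of `D2` applies. At a boundary point `z` the first half concentrates them near `z`, so the integrals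
tend to `f z`. Off the closure the integral is `f` itself. -/
theorem D2.continuous_integral_exitKernel (hd : 𝔛.IsDiffusion) {V : Set X} (hV : IsOpen V)
    (h1 : 𝔛.D1 V) (h2 : 𝔛.D2 V) {f : X → ℝ} (hf : Continuous f) :
    Continuous fun x => ∫ y, f y ∂(𝔛.exitKernel V x) := by
  have hout : ∀ x ∉ V, ∫ y, f y ∂(𝔛.exitKernel V x) = f x := fun x hx => by
    rw [𝔛.exitKernel_eq_dirac hd hV hx]
    exact integral_dirac' f x hf.measurable.stronglyMeasurable
  obtain ⟨C, hC0, hC⟩ := h1.exists_bound_frontier hf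
  rw [continuous_iff_continuousAt]
  intro z
  by_cases hz : z ∈ V
  · have hcont := h2.2 ((frontier V).indicator f)
      (hf.measurable.indicator isClosed_frontier.measurableSet) ⟨C, fun y => by
        by_cases hy : y ∈ frontier V
        · simpa [hy] using hC y hy
        · simpa [hy] using hC0⟩
    refine (hcont.congr fun x hx => integral_congr_ae ?_).continuousAt (hV.mem_nhds hz)
    filter_upwards [ae_mem_frontier_exitKernel hd hV hx] with y hy
    rw [indicator_of_mem hy]
  by_cases hz' : z ∈ closure V
  swap
  · refine hf.continuousAt.congr ?_
    filter_upwards [isClosed_closure.isOpen_compl.mem_nhds hz'] with x hx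
    exact (hout x fun h => hx (subset_closure h)).symm
  rw [Metric.continuousAt_iff', hout z hz]
  intro ε hε
  set W : Set X := {y | |f y - f z| < ε / 2} with hW
  have hWo : IsOpen W := isOpen_lt (hf.sub continuous_const).abs continuous_const
  have hzW : z ∈ W := by simp [hW, hε]
  -- `C + |f z|` bounds `|f y - f z|` for `y` on the boundary; it is needed only off `W`.
  have hlim : Tendsto (fun x => (C + |f z|) * (𝔛.exitKernel V x).real Wᶜ) (𝓝 z) (𝓝 0) := by
    have := (ENNReal.tendsto_toReal ENNReal.zero_ne_top).comp
      (h2.1 z ⟨hz', by rwa [hV.interior_eq]⟩ W hWo hzW)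
    simpa [Measure.real] using this.const_mul (C + |f z|)
  filter_upwards [hlim.eventually_lt_const (half_pos hε), hWo.mem_nhds hzW] with x hx hxW
  rw [Real.dist_eq]
  by_cases hxV : x ∈ V
  swap
  · rw [hout x hxV]
    exact lt_trans hxW (half_lt_self hε)
  have hprob := h1.isProbabilityMeasure_exitKernel hd hV x
  have hint := h1.integrable_exitKernel hd hV hf x
  have hWm : MeasurableSet Wᶜ := hWo.measurableSet.compl
  have hbound : ∀ᵐ y ∂(𝔛.exitKernel V x),
      |f y - f z| ≤ ε / 2 + Wᶜ.indicator (fun _ => C + |f z|) y := by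
    filter_upwards [ae_mem_frontier_exitKernel hd hV hxV] with y hy
    by_cases hyW : y ∈ W
    · rw [indicator_of_notMem (by simpa using hyW), add_zero]
      exact le_of_lt hyW
    · rw [indicator_of_mem (by exact hyW)]
      have := abs_sub (f y) (f z)
      have := hC y hy
      linarith
  have hi1 : Integrable (Wᶜ.indicator fun _ => C + |f z|) (𝔛.exitKernel V x) :=
    (integrable_const _).indicator hWm
  calc |∫ y, f y ∂(𝔛.exitKernel V x) - f z|
      = |∫ y, (f y - f z) ∂(𝔛.exitKernel V x)| := by
        rw [integral_sub hint (integrable_const _)]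
        simp
    _ ≤ ∫ y, |f y - f z| ∂(𝔛.exitKernel V x) := abs_integral_le_integral_abs
    _ ≤ ∫ y, (ε / 2 + Wᶜ.indicator (fun _ => C + |f z|) y) ∂(𝔛.exitKernel V x) :=
        integral_mono_ae (hint.sub (integrable_const _)).abs
          ((integrable_const _).add hi1) hbound
    _ = ε / 2 + (C + |f z|) * (𝔛.exitKernel V x).real Wᶜ := by
        rw [integral_add (integrable_const _) hi1, integral_indicator_const _ hWm]
        simp [mul_comm]
    _ < ε := by linarith

theorem continuous_lintegral_expectedExitTime (hd : 𝔛.IsDiffusion) {U V : Set X}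
    (hU : IsOpen U) (hV : IsOpen V) (hU1 : 𝔛.D1 U) (hU2 : 𝔛.D2 U) (hV1 : 𝔛.D1 V) :
    Continuous fun x => ∫⁻ y, 𝔛.expectedExitTime V y ∂(𝔛.exitKernel U x) := by
  have hfin := hV1.expectedExitTime_ne_top
  have hc : Continuous fun y => (𝔛.expectedExitTime V y).toReal :=
    ENNReal.continuousOn_toReal.comp_continuous (hV1.continuous_expectedExitTime hV) hfin
  have heq : ∀ x, ∫⁻ y, 𝔛.expectedExitTime V y ∂(𝔛.exitKernel U x) =
      ENNReal.ofReal (∫ y, (𝔛.expectedExitTime V y).toReal ∂(𝔛.exitKernel U x)) := by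
    intro x
    rw [ofReal_integral_eq_lintegral_ofReal (hU1.integrable_exitKernel hd hU hc x)
      (Eventually.of_forall fun y => ENNReal.toReal_nonneg)]
    simp only [ENNReal.ofReal_toReal (hfin _)]
  simp only [heq]
  exact ENNReal.continuous_ofReal.comp (hU2.continuous_integral_exitKernel hd hU hU1 hc)

/-- `H_W H_U p_V ≤ H_U p_V` for `U, W ⊆ V`. -/
theorem lintegral_lintegral_expectedExitTime_le (hd : 𝔛.IsDiffusion) {U V W : Set X}
    (hU : IsOpen U) (hV : IsOpen V) (hW : IsOpen W) (hUV : U ⊆ V) (hWV : W ⊆ V)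
    (hU1 : 𝔛.D1 U) (hV1 : 𝔛.D1 V) (x : X) :
    ∫⁻ z, ∫⁻ y, 𝔛.expectedExitTime V y ∂(𝔛.exitKernel U z) ∂(𝔛.exitKernel W x) ≤
      ∫⁻ y, 𝔛.expectedExitTime V y ∂(𝔛.exitKernel U x) := by
  set q : X → ℝ≥0∞ := fun z => ∫⁻ y, 𝔛.expectedExitTime V y ∂(𝔛.exitKernel U z) with hq
  have hpq : ∀ z, 𝔛.expectedExitTime V z = 𝔛.expectedExitTime U z + q z :=
    𝔛.expectedExitTime_eq hd hU hV hUV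
  have hint : ∫⁻ z, 𝔛.expectedExitTime V z ∂(𝔛.exitKernel W x) =
      ∫⁻ z, 𝔛.expectedExitTime U z ∂(𝔛.exitKernel W x) + ∫⁻ z, q z ∂(𝔛.exitKernel W x) := by
    simp only [hpq]
    exact lintegral_add_left (hU1.continuous_expectedExitTime hU).measurable _
  have hVW := 𝔛.expectedExitTime_eq hd hW hV hWV x
  have hfin := hV1.expectedExitTime_ne_top x
  rw [hVW, hint, ← add_assoc] at hfin
  have hle := 𝔛.expectedExitTime_le hd hU hW x
  -- Adding the finite `p_W + H_W p_U` turns the left side into `p_W + H_W p_V = p_V = p_U + q`, and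
  -- `p_U ≤ p_W + H_W p_U` finishes.
  rw [← ENNReal.add_le_add_iff_left (ENNReal.add_ne_top.1 hfin).1, add_assoc, ← hint, ← hVW, hpq x]
  gcongr

end Continuity

end HuntProcess

/-! ### The proposition -/

theorem proposition1p3 {X : Type*} [TopologicalSpace X] [T2Space X] [LocallyCompactSpace X]
    [SecondCountableTopology X] [MeasurableSpace X] [BorelSpace X]
    {Ω : Type*} [MeasurableSpace Ω] (𝔛 : HuntProcess X Ω) (h𝔛 : 𝔛.IsBauerDiffusion)
    (𝓥 : Set (Set X)) (h𝓥 : TopologicalSpace.IsTopologicalBasis 𝓥)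
    (hD : ∀ V ∈ 𝓥, 𝔛.D1 V ∧ 𝔛.D2 V) :
    (∀ U ∈ 𝓥, ∀ V ∈ 𝓥, closure U ⊆ V →
      IsHyperharmonic 𝓥 𝔛.exitKernel V (fun x => (𝔛.expectedExitTime V x : EReal)) ∧
      IsHyperharmonic 𝓥 𝔛.exitKernel V
        (fun x => ((∫⁻ y, 𝔛.expectedExitTime V y ∂(𝔛.exitKernel U x) : ℝ≥0∞) : EReal)) ∧
      ∀ x ∈ U,
        𝔛.expectedExitTime V x ≠ ⊤ ∧
        ∫⁻ y, 𝔛.expectedExitTime V y ∂(𝔛.exitKernel U x) ≠ ⊤ ∧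
        (𝔛.expectedExitTime V x : EReal) -
            ((∫⁻ y, 𝔛.expectedExitTime V y ∂(𝔛.exitKernel U x) : ℝ≥0∞) : EReal) =
          (𝔛.expectedExitTime U x : EReal) ∧
        0 < 𝔛.expectedExitTime U x) ∧
    IsNormalBauerFamily 𝓥 𝔛.exitKernel := by
  have hd := h𝔛.1
  have hopen : ∀ {V}, V ∈ 𝓥 → IsOpen V := fun hV => h𝓥.isOpen hV
  have hp : ∀ V ∈ 𝓥, IsHyperharmonic 𝓥 𝔛.exitKernel V
      (fun x => (𝔛.expectedExitTime V x : EReal)) := by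
    intro V hV
    refine isLocallyHyperharmonic_coe_ennreal
      ((hD V hV).1.continuous_expectedExitTime (hopen hV)) ?_
    rintro x - W ⟨hW, hWV, -⟩
    rw [𝔛.expectedExitTime_eq hd (hopen hW) (hopen hV) (subset_closure.trans hWV) x]
    exact le_add_self
  have hHp : ∀ U ∈ 𝓥, ∀ V ∈ 𝓥, closure U ⊆ V → IsHyperharmonic 𝓥 𝔛.exitKernel V
      (fun x => ((∫⁻ y, 𝔛.expectedExitTime V y ∂(𝔛.exitKernel U x) : ℝ≥0∞) : EReal)) := by
    intro U hU V hV hUV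
    refine isLocallyHyperharmonic_coe_ennreal (HuntProcess.continuous_lintegral_expectedExitTime hd
      (hopen hU) (hopen hV) (hD U hU).1 (hD U hU).2 (hD V hV).1) ?_
    rintro x - W ⟨hW, hWV, -⟩
    exact HuntProcess.lintegral_lintegral_expectedExitTime_le hd (hopen hU) (hopen hV) (hopen hW)
      (subset_closure.trans hUV) (subset_closure.trans hWV) (hD U hU).1 (hD V hV).1 x
  have hsum : ∀ U ∈ 𝓥, ∀ V ∈ 𝓥, closure U ⊆ V → ∀ x, 𝔛.expectedExitTime V x =
      𝔛.expectedExitTime U x + ∫⁻ y, 𝔛.expectedExitTime V y ∂(𝔛.exitKernel U x) :=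
    fun U hU V hV hUV x =>
      𝔛.expectedExitTime_eq hd (hopen hU) (hopen hV) (subset_closure.trans hUV) x
  have hHfin : ∀ U ∈ 𝓥, ∀ V ∈ 𝓥, closure U ⊆ V → ∀ x,
      ∫⁻ y, 𝔛.expectedExitTime V y ∂(𝔛.exitKernel U x) ≠ ⊤ := by
    intro U hU V hV hUV x
    have := (hD V hV).1.expectedExitTime_ne_top x
    rw [hsum U hU V hV hUV x] at this
    exact (ENNReal.add_ne_top.1 this).2
  refine ⟨fun U hU V hV hUV => ⟨hp V hV, hHp U hU V hV hUV, fun x hx =>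
    ⟨(hD V hV).1.expectedExitTime_ne_top x, hHfin U hU V hV hUV x, ?_,
      𝔛.expectedExitTime_pos hd (hopen hU) hx⟩⟩, ?_⟩
  · rw [hsum U hU V hV hUV x, EReal.coe_ennreal_add]
    -- Cancellation in `EReal` needs the subtracted term to be finite.
    lift ∫⁻ y, 𝔛.expectedExitTime V y ∂(𝔛.exitKernel U x) to ℝ≥0
      using hHfin U hU V hV hUV x with r
    exact EReal.add_sub_cancel_right
  · refine
      { isTopologicalBasis := h𝓥
        isCompact_closure := fun V hV => (hD V hV).1.1
        isBoundaryKernel := fun V hV => ⟨𝔛.measurable_exitKernel hd (hopen hV),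
          fun x hx => 𝔛.exitKernel_compl_frontier hd (hopen hV) hx,
          fun x hx => 𝔛.exitKernel_eq_dirac hd (hopen hV) hx⟩
        comp_eq := fun V hV W hW hWV x B hB =>
          𝔛.lintegral_exitKernel_exitKernel hd (hopen hW) (hopen hV) hWV x hB
        continuous := fun V hV f hf =>
          ⟨(hD V hV).1.integrable_exitKernel hd (hopen hV) hf,
            (hD V hV).2.continuous_integral_exitKernel hd (hopen hV) (hD V hV).1 hf⟩
        normal := fun V hV x =>
          𝔛.exitKernel_univ hd (hopen hV) ((hD V hV).1.expectedExitTime_ne_top x)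
        separates := fun V hV => ⟨fun x => {W | W ∈ 𝓥 ∧ closure W ⊆ V ∧ x ∈ W}, ?_, ?_⟩
        continuousOn := fun V hV => (hD V hV).2.2 }
    · intro x hx
      refine ⟨fun W hW => ⟨hW.1, hW.2.1⟩, ⟨fun s => ⟨fun hs => ?_, ?_⟩⟩⟩
      · obtain ⟨W, hW, hxW, hWs⟩ := h𝓥.exists_closure_subset
          (inter_mem hs ((hopen hV).mem_nhds hx))
        exact ⟨W, ⟨hW, hWs.trans inter_subset_right, hxW⟩,
          subset_closure.trans (hWs.trans inter_subset_left)⟩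
      · rintro ⟨W, ⟨hW, -, hxW⟩, hWs⟩
        exact mem_of_superset ((hopen hW).mem_nhds hxW) hWs
    · intro x hx y hy hxy
      by_cases heq : 𝔛.expectedExitTime V x = 𝔛.expectedExitTime V y
      swap
      · exact ⟨_, hp V hV, fun z _ => EReal.coe_ennreal_nonneg _,
          fun h => heq (EReal.coe_ennreal_injective h)⟩
      -- With `U` around `x` avoiding `y`, `H_U p_V` equals `p_V` at `y` but is smaller by `p_U x >
      -- 0` at `x`; as `p_V x = p_V y`, it separates the points.
      obtain ⟨U, hU, hxU, hUs⟩ := h𝓥.exists_closure_subset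
        (inter_mem ((hopen hV).mem_nhds hx) (isOpen_ne.mem_nhds hxy))
      have hUV : closure U ⊆ V := hUs.trans inter_subset_left
      have hyU : y ∉ U := fun h => (hUs (subset_closure h)).2 rfl
      refine ⟨_, hHp U hU V hV hUV, fun z _ => EReal.coe_ennreal_nonneg _, fun h => ?_⟩
      have h' := EReal.coe_ennreal_injective h
      have h1 := hsum U hU V hV hUV x
      have h2 := hsum U hU V hV hUV y
      rw [𝔛.expectedExitTime_eq_zero hyU, zero_add, ← h', ← heq, h1] at h2
      refine (𝔛.expectedExitTime_pos hd (hopen hU) hxU).ne' ?_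
      exact (ENNReal.add_left_inj (hHfin U hU V hV hUV x)).1 (h2.trans (zero_add _).symm)
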